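/- Let $P$ be an infinite field, let $n \ge 0$ be an integer, and let $P[X] = P[x_1,\dots,x_n]$ be the polynomial algebra over $P$ in $n$ commuting variables. Let $\mathrm{End}(P[X])$ be the semigroup, under composition, of all endomorphisms of the unital $P$-algebra $P[X]$. Then every automorphism $\tau$ of the semigroup $\mathrm{End}(P[X])$ is semi-inner. That is, there are an automorphism $\alpha$ of the field $P$ and a $P$-algebra automorphism $\eta$ of $P[X]$ such that, for the bijection $\mu = \overline{\alpha} \circ \eta$ of $P[X]$, $$\tau(s) = \mu \circ s \circ \mu^{-1} \qquad \text{for every } s \in \mathrm{End}(P[X]),$$ where $\overline{\alpha}$ is the extension of $\alpha$ to $P[X]$ coefficientwise: $\overline{\alpha}\left(\sum_k a_k u_k\right) = \sum_k \alpha(a_k) u_k$ for $a_k \in P$ and monomials $u_k$. -/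

import Mathlib

/-- The bijection `μ = α η` of `P[x₁, …, xₙ]`: first the `P`-algebra automorphism `η`, then the
field automorphism `α` of `P`, extended to polynomials coefficientwise. -/
noncomputable def semiInnerBijection {P : Type*} [Field P] {n : ℕ} (α : P ≃+* P)
    (η : MvPolynomial (Fin n) P ≃ₐ[P] MvPolynomial (Fin n) P) :
    MvPolynomial (Fin n) P ≃ MvPolynomial (Fin n) P :=
  η.toEquiv.trans (MvPolynomial.mapEquiv (Fin n) α).toEquiv

/-- A bijection `μ` of `P[x₁, …, xₙ]` generates the automorphism `τ` of the semigroup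
`End(P[x₁, …, xₙ])` (endomorphisms of the `P`-algebra, under composition) if
`τ(s) = μ s μ⁻¹` for every endomorphism `s`. -/
def Generates {P : Type*} [Field P] {n : ℕ}
    (μ : MvPolynomial (Fin n) P ≃ MvPolynomial (Fin n) P)
    (τ : (MvPolynomial (Fin n) P →ₐ[P] MvPolynomial (Fin n) P) ≃*
      (MvPolynomial (Fin n) P →ₐ[P] MvPolynomial (Fin n) P)) : Prop :=
  ∀ s : MvPolynomial (Fin n) P →ₐ[P] MvPolynomial (Fin n) P, ⇑(τ s) = μ ∘ s ∘ μ.symm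

/-- An automorphism of the semigroup `End(P[x₁, …, xₙ])` is semi-inner if it is generated by a
bijection `α η` with `α ∈ Aut(P)` and `η ∈ Aut(P[x₁, …, xₙ])`. -/
def IsSemiInner {P : Type*} [Field P] {n : ℕ}
    (τ : (MvPolynomial (Fin n) P →ₐ[P] MvPolynomial (Fin n) P) ≃*
      (MvPolynomial (Fin n) P →ₐ[P] MvPolynomial (Fin n) P)) : Prop :=
  ∃ (α : P ≃+* P) (η : MvPolynomial (Fin n) P ≃ₐ[P] MvPolynomial (Fin n) P),
    Generates (semiInnerBijection α η) τ

/-! Since P is infinite, endomorphisms are polynomial self-maps of P^n, with composition reversed.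
The constant maps are exactly the s with t * s = s for all t, so τ permutes them; this gives a
bijection σ of P^n through which τ acts by conjugation. It remains to show that σ is polynomial up
to a field automorphism.

Projection to a coordinate axis goes to an idempotent e whose fixed points form the σ-image of the
axis. Conjugating back to the axis shows that a nonzero element of the retract e(P[X]) has finitely
many zeros on this curve; divisibility in the UFD P[X] then gives e(P[X]) = P[s]. In the coordinate
s, σ restricted to the axis is a bijection β of P that conjugates affine maps to polynomial ones, so
β = aα + b. Maps into the axis and their conjugates carry this to all coordinates of σ and its
inverse. -/

/-- Any two polynomials in one variable over a field satisfy a nontrivial polynomial relation. -/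
theorem Polynomial.exists_bivariate_relation {P : Type*} [Field P] (f h : Polynomial P) :
    ∃ q : Polynomial (Polynomial P), q ≠ 0 ∧
      q.eval₂ (Polynomial.aeval f : Polynomial P →ₐ[P] Polynomial P).toRingHom h = 0 := by
  have hdep : ¬ AlgebraicIndependent P ![h, f] := by
    intro H
    have h1 := H.lift_cardinalMk_le_trdeg
    rw [Polynomial.trdeg_of_isDomain] at h1
    simp at h1
  rw [algebraicIndependent_iff] at hdep
  push Not at hdep
  obtain ⟨p, hp, hp0⟩ := hdep
  let ψ : MvPolynomial (Fin 2) P ≃ₐ[P] Polynomial (Polynomial P) :=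
    (MvPolynomial.finSuccEquiv P 1).trans
      (Polynomial.mapAlgEquiv (MvPolynomial.uniqueAlgEquiv P (Fin 1)))
  refine ⟨ψ p, by simpa using hp0, ?_⟩
  let χ : Polynomial (Polynomial P) →+* Polynomial P :=
    Polynomial.eval₂RingHom (Polynomial.aeval f : Polynomial P →ₐ[P] Polynomial P).toRingHom h
  have hχ : χ.comp (ψ : MvPolynomial (Fin 2) P →+* _) =
      (MvPolynomial.aeval ![h, f] : MvPolynomial (Fin 2) P →ₐ[P] _).toRingHom := by
    apply MvPolynomial.ringHom_ext
    · intro a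
      simp [χ, ψ, MvPolynomial.finSuccEquiv_apply, Polynomial.algebraMap_eq]
    · intro i
      refine Fin.cases ?_ (fun j => ?_) i
      · simp [χ, ψ, MvPolynomial.finSuccEquiv_apply]
      · simp [χ, ψ, MvPolynomial.finSuccEquiv_apply]
  have := congrArg (fun r => r p) hχ
  simp only [RingHom.comp_apply] at this
  exact this.trans hp

/-- A bijection of an infinite field which normalizes the affine maps modulo polynomial maps is the
composition of a field automorphism and an affine map. -/
theorem exists_ringEquiv_affine {P : Type*} [Field P] [Infinite P] (β : P ≃ P)
    (hβ : ∀ a b : P, ∃ p : Polynomial P, ∀ x, p.eval (β x) = β (a * x + b)) :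
    ∃ (α : P ≃+* P) (a b : P), a ≠ 0 ∧ ∀ x, β x = a * α x + b := by
  have haff : ∀ a b : P, a ≠ 0 → ∃ m k : P, ∀ x, β (a * x + b) = m * β x + k := by
    intro a b ha
    obtain ⟨p, hp⟩ := hβ a b
    obtain ⟨q, hq⟩ := hβ a⁻¹ (-(a⁻¹ * b))
    have hpq : q.comp p = Polynomial.X := by
      apply Polynomial.funext
      intro y
      obtain ⟨x, rfl⟩ := β.surjective y
      rw [Polynomial.eval_comp, hp, hq, Polynomial.eval_X]
      congr 1
      field_simp
      ring
    have hdeg : q.natDegree * p.natDegree = 1 := by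
      rw [← Polynomial.natDegree_comp, hpq, Polynomial.natDegree_X]
    have hp1 : p.natDegree = 1 := Nat.eq_one_of_mul_eq_one_left hdeg
    refine ⟨p.coeff 1, p.coeff 0, fun x => ?_⟩
    rw [← hp, Polynomial.eval_eq_sum_range, hp1]
    simp [Finset.sum_range_succ]
    ring
  have htrans : ∀ x y, β (x + y) = β x + (β y - β 0) := by
    intro x y
    by_cases hy : y = 0
    · simp [hy]
    obtain ⟨m, k, h⟩ := haff 1 y one_ne_zero
    -- If m ≠ 1, the map y ↦ m * y + k has a fixed point, but it is conjugate to a nontrivial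
    -- translation.
    have hm : m = 1 := by
      by_contra hm
      obtain ⟨x, hx⟩ := β.surjective (k / (1 - m))
      have h1 := h x
      have hm' : 1 - m ≠ 0 := sub_ne_zero.2 (Ne.symm hm)
      rw [hx, show m * (k / (1 - m)) + k = k / (1 - m) by field_simp; ring, ← hx] at h1
      exact hy (by simpa using β.injective h1)
    have h0 := h 0
    have h1 := h x
    simp only [hm, one_mul, mul_zero, zero_add] at h0 h1
    rw [add_comm x y, h0, add_comm y x, h1]
    ring
  let c := β 1 - β 0
  have hc : c ≠ 0 := sub_ne_zero.2 fun h => one_ne_zero (β.injective h)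
  have hmul : ∀ x y, (β (x * y) - β 0) * c = (β x - β 0) * (β y - β 0) := by
    intro x y
    by_cases hx : x = 0
    · simp [hx]
    obtain ⟨m, k, h⟩ := haff x 0 hx
    have h0 := h 0
    have h1 := h 1
    have h2 := h y
    simp only [add_zero, mul_zero, mul_one] at h0 h1 h2
    simp only [c]
    have e1 : β (x * y) - β 0 = m * (β y - β 0) := by linear_combination h2 - h0
    have e2 : β x - β 0 = m * (β 1 - β 0) := by linear_combination h1 - h0
    rw [e1, e2]; ring
  let α : P ≃+* P :=
    { toEquiv := β.trans ((Equiv.subRight (β 0)).trans (Equiv.divRight₀ c hc))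
      map_mul' := by
        intro x y
        simp only [Equiv.toFun_as_coe, Equiv.trans_apply, Equiv.subRight_apply,
          Equiv.divRight₀_apply]
        rw [div_mul_div_comm, ← hmul, mul_div_mul_right _ _ hc]
      map_add' := by
        intro x y
        simp only [Equiv.toFun_as_coe, Equiv.trans_apply, Equiv.subRight_apply,
          Equiv.divRight₀_apply]
        rw [htrans]; ring }
  refine ⟨α, c, β 0, hc, fun x => ?_⟩
  have : α x = (β x - β 0) / c := rfl
  rw [this, mul_div_cancel₀ _ hc]
  ring

/-! ### Endomorphisms as polynomial maps -/

/-- The polynomial self-map of affine space defined by an endomorphism of the polynomial algebra. -/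
noncomputable def pointMap {P ι : Type*} [Field P]
    (s : MvPolynomial ι P →ₐ[P] MvPolynomial ι P) (v : ι → P) : ι → P :=
  fun i => MvPolynomial.eval v (s (MvPolynomial.X i))

theorem MvPolynomial.eval_polynomial_aeval {P ι : Type*} [CommRing P] (v : ι → P)
    (f : MvPolynomial ι P) (p : Polynomial P) :
    MvPolynomial.eval v (Polynomial.aeval f p) = p.eval (MvPolynomial.eval v f) := by
  have : (MvPolynomial.aeval v : MvPolynomial ι P →ₐ[P] P).comp (Polynomial.aeval f) =
      Polynomial.aeval (MvPolynomial.eval v f) := by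
    ext
    simp [MvPolynomial.aeval_eq_eval]
  simpa [MvPolynomial.aeval_eq_eval, Polynomial.coe_aeval_eq_eval] using
    congrArg (fun r => r p) this

theorem Polynomial.eval_mvPolynomial_aeval {P ι : Type*} [CommRing P] (φ : ι → Polynomial P)
    (w : MvPolynomial ι P) (t : P) :
    (MvPolynomial.aeval φ w).eval t = MvPolynomial.eval (fun i => (φ i).eval t) w := by
  have : (Polynomial.aeval t).comp (MvPolynomial.aeval φ) =
      (MvPolynomial.aeval fun i => (φ i).eval t : MvPolynomial ι P →ₐ[P] P) := by
    ext i
    simp [Polynomial.coe_aeval_eq_eval]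
  simpa [MvPolynomial.aeval_eq_eval, Polynomial.coe_aeval_eq_eval] using
    congrArg (fun r => r w) this

section PointMap

variable {P ι : Type*} [Field P]

theorem eval_algHom_apply (s : MvPolynomial ι P →ₐ[P] MvPolynomial ι P) (v : ι → P)
    (p : MvPolynomial ι P) :
    MvPolynomial.eval v (s p) = MvPolynomial.eval (pointMap s v) p := by
  have : ((MvPolynomial.aeval v).comp s : MvPolynomial ι P →ₐ[P] P) =
      MvPolynomial.aeval (pointMap s v) := by
    apply MvPolynomial.algHom_ext
    intro i
    rw [MvPolynomial.aeval_X, AlgHom.comp_apply, MvPolynomial.aeval_eq_eval]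
    rfl
  simpa [MvPolynomial.aeval_eq_eval] using congrArg (fun r => r p) this

theorem pointMap_mul (s t : MvPolynomial ι P →ₐ[P] MvPolynomial ι P) (v : ι → P) :
    pointMap (s * t) v = pointMap t (pointMap s v) := by
  funext i
  change MvPolynomial.eval v (s (t (MvPolynomial.X i))) = _
  rw [eval_algHom_apply]
  rfl

theorem pointMap_injective [Infinite P] :
    Function.Injective (pointMap : (MvPolynomial ι P →ₐ[P] MvPolynomial ι P) → _) := by
  intro s t h
  apply MvPolynomial.algHom_ext
  intro i
  apply MvPolynomial.funext
  intro v
  exact congrFun (congrFun h v) i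

/-- The endomorphism evaluating polynomials at a point. -/
noncomputable def constEnd (c : ι → P) : MvPolynomial ι P →ₐ[P] MvPolynomial ι P :=
  MvPolynomial.aeval fun i => MvPolynomial.C (c i)

@[simp]
theorem pointMap_constEnd (c v : ι → P) : pointMap (constEnd c) v = c := by
  funext i
  simp [pointMap, constEnd]

theorem constEnd_injective : Function.Injective (constEnd : (ι → P) → _) := fun c d h => by
  simpa using congrArg (fun s => pointMap s (0 : ι → P)) h

theorem constEnd_mul [Infinite P] (c : ι → P) (s : MvPolynomial ι P →ₐ[P] MvPolynomial ι P) :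
    constEnd c * s = constEnd (pointMap s c) := by
  apply pointMap_injective
  funext v
  simp [pointMap_mul]

theorem mul_constEnd [Infinite P] (c : ι → P) (s : MvPolynomial ι P →ₐ[P] MvPolynomial ι P) :
    s * constEnd c = constEnd c := by
  apply pointMap_injective
  funext v
  simp [pointMap_mul]

/-- With `mul_constEnd`, this characterizes constants multiplicatively, so automorphisms preserve
them. -/
theorem exists_eq_constEnd [Infinite P] {s : MvPolynomial ι P →ₐ[P] MvPolynomial ι P}
    (h : ∀ t, t * s = s) : ∃ c, s = constEnd c :=
  ⟨pointMap s 0, by rw [← constEnd_mul, h]⟩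

/-- An automorphism of the endomorphism semigroup is induced by a bijection of affine space. -/
theorem exists_pointPerm [Infinite P]
    (τ : (MvPolynomial ι P →ₐ[P] MvPolynomial ι P) ≃* (MvPolynomial ι P →ₐ[P] MvPolynomial ι P)) :
    ∃ σ : (ι → P) ≃ (ι → P), ∀ s c, pointMap (τ s) (σ c) = σ (pointMap s c) := by
  have key : ∀ (τ : (MvPolynomial ι P →ₐ[P] MvPolynomial ι P) ≃*
      (MvPolynomial ι P →ₐ[P] MvPolynomial ι P)) (c : ι → P),
      ∃ d, τ (constEnd c) = constEnd d := by
    intro τ c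
    apply exists_eq_constEnd
    intro t
    obtain ⟨u, rfl⟩ := τ.surjective t
    rw [← map_mul, mul_constEnd]
  choose f hf using key τ
  choose g hg using key τ.symm
  refine ⟨⟨f, g, fun c => ?_, fun c => ?_⟩, fun s c => ?_⟩
  · apply constEnd_injective
    rw [← hg, ← hf, MulEquiv.symm_apply_apply]
  · apply constEnd_injective
    rw [← hf, ← hg, MulEquiv.apply_symm_apply]
  · apply constEnd_injective
    change constEnd (pointMap (τ s) (f c)) = constEnd (f (pointMap s c))
    rw [← constEnd_mul, ← hf, ← hf, ← map_mul, constEnd_mul]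

end PointMap

/-! ### One-dimensional retracts -/

/-- A polynomial function on an infinite field taking two values has infinite range. -/
theorem Polynomial.infinite_range_eval {P : Type*} [Field P] [Infinite P] {g : Polynomial P}
    {a b : P} (h : g.eval a ≠ g.eval b) : (Set.range fun t => g.eval t).Infinite := by
  intro hfin
  have := hfin.to_subtype
  obtain ⟨y, hy⟩ := Finite.exists_infinite_fiber (Set.rangeFactorization fun t => g.eval t)
  have hg : g = Polynomial.C y.1 := by
    apply Polynomial.eq_of_infinite_eval_eq
    refine (Set.infinite_coe_iff.1 hy).mono fun t ht => ?_
    have : (Set.rangeFactorization (fun t => g.eval t) t).1 = y.1 := congrArg Subtype.val ht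
    simpa using this
  apply h
  rw [hg, Polynomial.eval_C, Polynomial.eval_C]

section Retract

variable {P ι : Type*} [Field P] [Infinite P]

/-- If a nontrivial retract of a polynomial algebra contains no nonzero polynomial vanishing at
infinitely many points of the corresponding retract of affine space, then it is a polynomial
algebra in one variable. -/
theorem exists_parametrization (e : MvPolynomial ι P →ₐ[P] MvPolynomial ι P) (he : e * e = e)
    {c₀ c₁ : ι → P} (hc : c₀ ≠ c₁) (h₀ : pointMap e c₀ = c₀) (h₁ : pointMap e c₁ = c₁)
    (hvan : ∀ w, e w = w →
      {v | pointMap e v = v ∧ MvPolynomial.eval v w = 0}.Infinite → w = 0) :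
    ∃ (s : MvPolynomial ι P) (φ : ι → Polynomial P), e s = s ∧
      (∀ v i, pointMap e v i = (φ i).eval (MvPolynomial.eval v s)) ∧
      ∀ t, MvPolynomial.eval (fun i => (φ i).eval t) s = t := by
  have hee : ∀ w, e (e w) = e w := fun w => congrArg (fun r => r w) he
  have hpee : ∀ v, pointMap e (pointMap e v) = pointMap e v := fun v => by
    rw [← pointMap_mul, he]
  obtain ⟨i₁, hi₁⟩ := Function.ne_iff.1 hc
  -- restriction to the image of a line
  let line : MvPolynomial ι P →ₐ[P] Polynomial P :=
    MvPolynomial.aeval fun i => Polynomial.C (c₀ i) + Polynomial.C (c₁ i - c₀ i) * Polynomial.X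
  let Γ : MvPolynomial ι P →ₐ[P] Polynomial P := line.comp e
  let γ : P → ι → P := fun t => pointMap e fun i => c₀ i + (c₁ i - c₀ i) * t
  have hline : ∀ w t, (line w).eval t =
      MvPolynomial.eval (fun i => c₀ i + (c₁ i - c₀ i) * t) w := by
    intro w t
    simp only [line, Polynomial.eval_mvPolynomial_aeval, Polynomial.eval_add, Polynomial.eval_mul,
      Polynomial.eval_C, Polynomial.eval_X]
  have hΓ : ∀ w t, (Γ w).eval t = MvPolynomial.eval (γ t) w := by
    intro w t
    rw [← eval_algHom_apply, ← hline]
    rfl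
  have hγ : ∀ t, pointMap e (γ t) = γ t := fun t => hpee _
  have hγ0 : γ 0 = c₀ := by simp only [γ, mul_zero, add_zero]; exact h₀
  have hγ1 : γ 1 = c₁ := by
    simp only [γ, mul_one, add_sub_cancel]; exact h₁
  have hγinf : (Set.range γ).Infinite := by
    have h := Polynomial.infinite_range_eval (g := Γ (MvPolynomial.X i₁)) (a := 0) (b := 1)
      (by simpa [hΓ, hγ0, hγ1] using hi₁)
    refine Set.Infinite.of_image (fun v => v i₁) (h.mono ?_)
    rintro _ ⟨t, rfl⟩
    exact ⟨γ t, ⟨t, rfl⟩, by simp [hΓ]⟩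
  have hΓinj : ∀ w, e w = w → Γ w = 0 → w = 0 := by
    intro w hw hΓw
    refine hvan w hw (hγinf.mono ?_)
    rintro _ ⟨t, rfl⟩
    exact ⟨hγ t, by rw [← hΓ, hΓw, Polynomial.eval_zero]⟩
  -- the generator
  let h : MvPolynomial ι P := e (MvPolynomial.X i₁) - MvPolynomial.C (c₀ i₁)
  have hC : ∀ a : P, e (MvPolynomial.C a) = MvPolynomial.C a := fun a => e.commutes a
  have heh : e h = h := by simp only [h, map_sub, hee, hC]
  have hh0 : MvPolynomial.eval c₀ h = 0 := by
    simp [h, eval_algHom_apply, h₀]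
  have hh : h ≠ 0 := by
    intro hz
    have : MvPolynomial.eval c₁ h = 0 := by rw [hz, map_zero]
    simp only [h, map_sub, eval_algHom_apply, h₁, MvPolynomial.eval_X, MvPolynomial.eval_C] at this
    exact hi₁ (sub_eq_zero.1 this).symm
  -- The prime q need not lie in the retract; its image under e will generate.
  obtain ⟨q, hqprime, hqh, hq0⟩ : ∃ q, Prime q ∧ q ∣ h ∧ MvPolynomial.eval c₀ q = 0 := by
    obtain ⟨m, hm, hmh⟩ := UniqueFactorizationMonoid.exists_prime_factors h hh
    have h1 : MvPolynomial.eval c₀ m.prod = 0 :=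
      eq_zero_of_zero_dvd (hh0 ▸ map_dvd (MvPolynomial.eval c₀) hmh.symm.dvd)
    rw [map_multiset_prod, Multiset.prod_eq_zero_iff, Multiset.mem_map] at h1
    obtain ⟨q, hq, hq0⟩ := h1
    exact ⟨q, hm q hq, (Multiset.dvd_prod hq).trans hmh.dvd, hq0⟩
  let s := e q
  have hes : e s = s := hee q
  have hs0 : MvPolynomial.eval c₀ s = 0 := by rw [eval_algHom_apply, h₀, hq0]
  have hsne : s ≠ 0 := by
    intro hz
    have h1 : e q ∣ e h := map_dvd e hqh
    rw [heh] at h1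
    change s ∣ h at h1
    rw [hz] at h1
    exact hh (eq_zero_of_zero_dvd h1)
  -- A relation between f and h, with powers of h cancelled, makes h divide a nonzero polynomial in
  -- f. Write it as f^m * g(f) with g(0) ≠ 0: since g(f) is nonzero at c₀, the prime q divides f.
  have hdiv : ∀ f, e f = f → MvPolynomial.eval c₀ f = 0 → ∃ k, e k = k ∧ f = s * k := by
    intro f hf hf0
    suffices q ∣ f by
      obtain ⟨k, hk⟩ := this
      refine ⟨e k, hee k, ?_⟩
      rw [← hf, hk, map_mul]
    obtain ⟨Q, hQ, hQ0⟩ := Polynomial.exists_bivariate_relation (Γ f) (Γ h)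
    obtain ⟨Q', hQQ', hQ'⟩ := Polynomial.exists_eq_pow_rootMultiplicity_mul_and_not_dvd Q hQ 0
    rw [Polynomial.C_0, sub_zero] at hQQ' hQ'
    have hcoeff : Q'.coeff 0 ≠ 0 := fun hz => hQ' (Polynomial.X_dvd_iff.2 hz)
    let F : Polynomial P →ₐ[P] MvPolynomial ι P := Polynomial.aeval f
    have hΓh : Γ h ≠ 0 := fun hz => hh (hΓinj h heh hz)
    have hrel : Q'.eval₂ F.toRingHom h = 0 := by
      apply hΓinj
      · have : e.toRingHom.comp F.toRingHom = F.toRingHom := by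
          have : e.comp F = F := by ext; simp [F, hf]
          exact congrArg AlgHom.toRingHom this
        have h2 := Polynomial.hom_eval₂ Q' F.toRingHom e.toRingHom h
        rw [this] at h2
        exact h2.trans (congrArg (fun r => Q'.eval₂ F.toRingHom r) heh)
      · have : Γ.toRingHom.comp F.toRingHom =
            (Polynomial.aeval (Γ f) : Polynomial P →ₐ[P] Polynomial P).toRingHom := by
          have : Γ.comp F = Polynomial.aeval (Γ f) := by ext; simp [F]
          exact congrArg AlgHom.toRingHom this
        have h2 := Polynomial.hom_eval₂ Q' F.toRingHom Γ.toRingHom h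
        rw [this] at h2
        refine h2.trans ?_
        rw [hQQ', Polynomial.eval₂_mul, Polynomial.eval₂_pow, Polynomial.eval₂_X] at hQ0
        exact (mul_eq_zero.1 hQ0).resolve_left (pow_ne_zero _ hΓh)
    have hdvd : h ∣ F (Q'.coeff 0) := by
      have h2 := congrArg (Polynomial.eval₂ F.toRingHom h) Q'.divX_mul_X_add
      rw [Polynomial.eval₂_add, Polynomial.eval₂_mul, Polynomial.eval₂_X, Polynomial.eval₂_C,
        hrel] at h2
      exact ⟨-(Polynomial.eval₂ F.toRingHom h Q'.divX), by linear_combination h2⟩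
    obtain ⟨g, hg, hg'⟩ :=
      Polynomial.exists_eq_pow_rootMultiplicity_mul_and_not_dvd (Q'.coeff 0) hcoeff 0
    rw [Polynomial.C_0, sub_zero] at hg hg'
    have hg0 : g.coeff 0 ≠ 0 := fun hz => hg' (Polynomial.X_dvd_iff.2 hz)
    have hqd := hqh.trans hdvd
    rw [hg, map_mul, map_pow] at hqd
    rcases hqprime.dvd_or_dvd hqd with h3 | h3
    · simpa [F] using hqprime.dvd_of_dvd_pow h3
    · exfalso
      have h4 := map_dvd (MvPolynomial.eval c₀) h3
      rw [hq0, zero_dvd_iff, MvPolynomial.eval_polynomial_aeval, hf0,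
        ← Polynomial.coeff_zero_eq_eval_zero] at h4
      exact hg0 h4
  have hsdeg : 0 < s.totalDegree := by
    rw [Nat.pos_iff_ne_zero]
    intro hz
    rw [MvPolynomial.totalDegree_eq_zero_iff_eq_C] at hz
    rw [hz, MvPolynomial.eval_C] at hs0
    exact hsne (by rw [hz, hs0, MvPolynomial.C_0])
  -- Subtracting the value at c₀ and dividing by s lowers the degree.
  have hgen : ∀ (n : ℕ) (f : MvPolynomial ι P), f.totalDegree < n → e f = f →
      ∃ p : Polynomial P, f = Polynomial.aeval s p := by
    intro n
    induction n with
    | zero => intro f hf; omega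
    | succ n ih =>
      intro f hf hef
      obtain ⟨k, hk, hfk⟩ := hdiv (f - MvPolynomial.C (MvPolynomial.eval c₀ f))
        (by rw [map_sub, hef, hC]) (by simp)
      by_cases hk0 : k = 0
      · refine ⟨Polynomial.C (MvPolynomial.eval c₀ f), ?_⟩
        rw [hk0, mul_zero, sub_eq_zero] at hfk
        rw [Polynomial.aeval_C]
        exact hfk
      · have hd := MvPolynomial.totalDegree_mul_of_isDomain hsne hk0
        rw [← hfk] at hd
        have hd' := MvPolynomial.totalDegree_sub_C_le f (MvPolynomial.eval c₀ f)
        obtain ⟨p, hp⟩ := ih k (by omega) hk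
        refine ⟨Polynomial.X * p + Polynomial.C (MvPolynomial.eval c₀ f), ?_⟩
        rw [map_add, map_mul, Polynomial.aeval_X, ← hp, Polynomial.aeval_C]
        exact sub_eq_iff_eq_add.1 hfk
  choose φ hφ using fun i => hgen _ (e (MvPolynomial.X i)) (Nat.lt_succ_self _) (hee _)
  have hφv : ∀ v i, pointMap e v i = (φ i).eval (MvPolynomial.eval v s) := by
    intro v i
    rw [← MvPolynomial.eval_polynomial_aeval, ← hφ]
    rfl
  refine ⟨s, φ, hes, hφv, ?_⟩
  have hinf : (Set.range fun t => (Γ s).eval t).Infinite := by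
    obtain ⟨t, ht⟩ : ∃ t, (Γ s).eval t ≠ 0 := by
      by_contra! hz
      exact hsne (hΓinj s hes (Polynomial.funext fun t => by rw [hz, Polynomial.eval_zero]))
    exact Polynomial.infinite_range_eval (a := t) (b := 0) (by rwa [hΓ s 0, hγ0, hs0])
  let p : Polynomial P := MvPolynomial.aeval φ s
  have hp : ∀ t, p.eval t = MvPolynomial.eval (fun i => (φ i).eval t) s :=
    Polynomial.eval_mvPolynomial_aeval φ s
  -- The identity holds at the values of s on the curve, which are infinitely many.
  have hpX : p = Polynomial.X := by
    apply Polynomial.eq_of_infinite_eval_eq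
    refine hinf.mono ?_
    rintro _ ⟨t, rfl⟩
    simp only [Set.mem_ofPred_eq, Polynomial.eval_X, hp, hΓ, ← hφv]
    rw [← eval_algHom_apply, hes]
  intro t
  rw [← hp, hpX, Polynomial.eval_X]

end Retract

/-! ### The bijection is polynomial up to a field automorphism -/

section PolynomialPermutation

variable {P ι : Type*} [Field P]

open Classical in
/-- The endomorphism whose point map sends `v` to the point `f v` of the `i₀`-th axis. -/
noncomputable def axisEnd (i₀ : ι) (f : MvPolynomial ι P) :
    MvPolynomial ι P →ₐ[P] MvPolynomial ι P :=
  MvPolynomial.aeval (Pi.single i₀ f)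

open Classical in
theorem pointMap_axisEnd (i₀ : ι) (f : MvPolynomial ι P) (v : ι → P) :
    pointMap (axisEnd i₀ f) v = Pi.single i₀ (MvPolynomial.eval v f) := by
  funext i
  by_cases h : i = i₀
  · subst h; simp [pointMap, axisEnd]
  · simp [pointMap, axisEnd, h]

open Classical in
/-- A bijection of affine space which conjugates polynomial maps to polynomial maps is, up to a
field automorphism, a polynomial automorphism. -/
theorem exists_semiPolynomial [Infinite P] (i₀ : ι)
    (τ : (MvPolynomial ι P →ₐ[P] MvPolynomial ι P) ≃* (MvPolynomial ι P →ₐ[P] MvPolynomial ι P))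
    (σ : (ι → P) ≃ (ι → P)) (hσ : ∀ s c, pointMap (τ s) (σ c) = σ (pointMap s c)) :
    ∃ (α : P ≃+* P) (g k : ι → MvPolynomial ι P),
      (∀ v i, MvPolynomial.eval (σ v) (g i) = α (v i)) ∧
      ∀ v i, MvPolynomial.eval v (k i) = α.symm (σ v i) := by
  let e := τ (axisEnd i₀ (MvPolynomial.X i₀))
  have haxis : ∀ v : ι → P, pointMap (axisEnd i₀ (MvPolynomial.X i₀)) v = Pi.single i₀ (v i₀) := by
    intro v
    rw [pointMap_axisEnd, MvPolynomial.eval_X]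
  have he : e * e = e := by
    simp only [e, ← map_mul]
    congr 1
    apply pointMap_injective
    funext v
    rw [pointMap_mul, haxis, haxis, Pi.single_eq_same]
  have hfix : ∀ t, pointMap e (σ (Pi.single i₀ t)) = σ (Pi.single i₀ t) := by
    intro t
    rw [hσ, haxis, Pi.single_eq_same]
  have hfix' : ∀ v, pointMap e v = v → v = σ (Pi.single i₀ (σ.symm v i₀)) := by
    intro v hv
    obtain ⟨u, rfl⟩ := σ.surjective v
    rw [← haxis, Equiv.symm_apply_apply, ← hσ, hv]
  have hne : σ (Pi.single i₀ 0) ≠ σ (Pi.single i₀ 1) := fun h => by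
    have := congrFun (σ.injective h) i₀
    simp at this
  have hvan : ∀ w, e w = w →
      {v | pointMap e v = v ∧ MvPolynomial.eval v w = 0}.Infinite → w = 0 := by
    intro w hw hinf
    by_contra hw0
    obtain ⟨v, hv⟩ : ∃ v, MvPolynomial.eval v w ≠ 0 := by
      by_contra! h
      exact hw0 (MvPolynomial.funext fun v => by rw [h, map_zero])
    rw [← hw, eval_algHom_apply] at hv
    have hv' : pointMap e (pointMap e v) = pointMap e v := by rw [← pointMap_mul, he]
    generalize pointMap e v = c at hv hv'
    let c₀ : ι → P := σ (Pi.single i₀ 0)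
    let c₁ : ι → P := σ (Pi.single i₀ 1)
    -- F collapses the zeros of w to c₀ and sends c to c₁. Pulled back to the axis, it gives a
    -- one-variable polynomial with infinitely many zeros and a value 1.
    let F : MvPolynomial ι P →ₐ[P] MvPolynomial ι P := MvPolynomial.aeval fun i =>
      MvPolynomial.C (c₀ i) + MvPolynomial.C ((c₁ i - c₀ i) / MvPolynomial.eval c w) * w
    have hF0 : ∀ v, MvPolynomial.eval v w = 0 → pointMap F v = c₀ := by
      intro v hv
      funext i
      simp [pointMap, F, hv]
    have hFc : pointMap F c = c₁ := by
      funext i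
      simp [pointMap, F, hv]
    have hG : ∀ v, pointMap (τ.symm F) (σ.symm v) = σ.symm (pointMap F v) := by
      intro v
      apply σ.injective
      rw [← hσ, MulEquiv.apply_symm_apply, Equiv.apply_symm_apply, Equiv.apply_symm_apply]
    let p : Polynomial P :=
      MvPolynomial.aeval (Pi.single i₀ Polynomial.X) (τ.symm F (MvPolynomial.X i₀))
    have hp : ∀ t, p.eval t = pointMap (τ.symm F) (Pi.single i₀ t) i₀ := by
      intro t
      refine (Polynomial.eval_mvPolynomial_aeval _ _ _).trans ?_
      unfold pointMap
      congr 2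
      funext i
      by_cases h : i = i₀
      · subst h; simp
      · simp [h]
    have hpv : ∀ v, pointMap e v = v →
        p.eval (σ.symm v i₀) = σ.symm (pointMap F v) i₀ := by
      intro v hv
      rw [hp, ← hG]
      congr 2
      apply σ.injective
      rw [← hfix' v hv, Equiv.apply_symm_apply]
    have hp0 : p = 0 := by
      apply Polynomial.eq_zero_of_infinite_isRoot
      refine (hinf.image (f := fun v => σ.symm v i₀) ?_).mono ?_
      · rintro u ⟨hu, -⟩ v ⟨hv, -⟩ huv
        rw [hfix' u hu, hfix' v hv]
        exact congrArg (fun t => σ (Pi.single i₀ t)) huv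
      · rintro _ ⟨u, ⟨hu, hu0⟩, rfl⟩
        change p.eval _ = 0
        rw [hpv u hu, hF0 u hu0, Equiv.symm_apply_apply, Pi.single_eq_same]
    have h1 := hpv c hv'
    rw [hp0, hFc, Equiv.symm_apply_apply, Pi.single_eq_same, Polynomial.eval_zero] at h1
    exact zero_ne_one h1
  obtain ⟨s, φ, -, hφ, hsφ⟩ := exists_parametrization e he hne (hfix 0) (hfix 1) hvan
  let Φ : P → ι → P := fun t i => (φ i).eval t
  have hΦ : ∀ v, Φ (MvPolynomial.eval v s) = pointMap e v := fun v => funext fun i => (hφ v i).symm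
  have hΦfix : ∀ t, pointMap e (Φ t) = Φ t := by
    intro t
    rw [← hΦ, hsφ]
  let β : P ≃ P :=
    { toFun := fun t => MvPolynomial.eval (σ (Pi.single i₀ t)) s
      invFun := fun t => σ.symm (Φ t) i₀
      left_inv := by
        intro t
        change σ.symm (Φ (MvPolynomial.eval (σ (Pi.single i₀ t)) s)) i₀ = t
        rw [hΦ, hfix, Equiv.symm_apply_apply, Pi.single_eq_same]
      right_inv := by
        intro t
        change MvPolynomial.eval (σ (Pi.single i₀ (σ.symm (Φ t) i₀))) s = t
        rw [← hfix' _ (hΦfix t)]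
        exact hsφ t }
  have hΦβ : ∀ t, Φ (β t) = σ (Pi.single i₀ t) := fun t => (hΦ _).trans (hfix t)
  have hτaxis : ∀ f v, MvPolynomial.eval (σ v) (τ (axisEnd i₀ f) s) =
      β (MvPolynomial.eval v f) := by
    intro f v
    rw [eval_algHom_apply, hσ, pointMap_axisEnd]
    rfl
  obtain ⟨α, a, b, ha, hαβ⟩ := exists_ringEquiv_affine β (by
    intro a b
    refine ⟨MvPolynomial.aeval φ (τ (axisEnd i₀
      (MvPolynomial.C a * MvPolynomial.X i₀ + MvPolynomial.C b)) s), fun x => ?_⟩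
    rw [Polynomial.eval_mvPolynomial_aeval]
    change MvPolynomial.eval (Φ (β x)) _ = _
    rw [hΦβ, hτaxis]
    simp)
  -- Since a * x + b = β (α.symm x), this polynomial map is v ↦ σ (α.symm (v i) on the axis);
  -- conjugating back by σ yields k i.
  let F : ι → MvPolynomial ι P →ₐ[P] MvPolynomial ι P := fun i => MvPolynomial.aeval fun j =>
    Polynomial.aeval (MvPolynomial.C a * MvPolynomial.X i + MvPolynomial.C b) (φ j)
  have hF : ∀ i v, pointMap (F i) v = σ (Pi.single i₀ (α.symm (v i))) := by
    intro i v
    rw [← hΦβ, hαβ]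
    funext j
    simp [pointMap, F, MvPolynomial.eval_polynomial_aeval, Φ]
  refine ⟨α, fun i => MvPolynomial.C a⁻¹ * (τ (axisEnd i₀ (MvPolynomial.X i)) s - MvPolynomial.C b),
    fun i => τ.symm (F i) (MvPolynomial.X i₀), fun v i => ?_, fun v i => ?_⟩
  · simp [hτaxis, hαβ, ha]
  · change pointMap (τ.symm (F i)) v i₀ = _
    have : pointMap (τ.symm (F i)) v = Pi.single i₀ (α.symm (σ v i)) := by
      apply σ.injective
      rw [← hσ, MulEquiv.apply_symm_apply, hF]
    rw [this, Pi.single_eq_same]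

end PolynomialPermutation

/-! ### Semi-innerness -/

theorem MvPolynomial.eval_map_ringEquiv {P ι : Type*} [CommRing P] (α : P ≃+* P) (v : ι → P)
    (p : MvPolynomial ι P) :
    MvPolynomial.eval v (MvPolynomial.map (α : P →+* P) p) =
      α (MvPolynomial.eval (fun i => α.symm (v i)) p) := by
  induction p using MvPolynomial.induction_on with
  | C a => simp
  | add p q hp hq => simp [hp, hq]
  | mul_X p i hp => simp [hp]

theorem mainTheorem1 {P : Type*} [Field P] [Infinite P] (n : ℕ)
    (τ : (MvPolynomial (Fin n) P →ₐ[P] MvPolynomial (Fin n) P) ≃*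
      (MvPolynomial (Fin n) P →ₐ[P] MvPolynomial (Fin n) P)) :
    IsSemiInner τ := by
  obtain ⟨σ, hσ⟩ := exists_pointPerm τ
  obtain ⟨α, g, k, hg, hk⟩ : ∃ (α : P ≃+* P) (g k : Fin n → MvPolynomial (Fin n) P),
      (∀ v i, MvPolynomial.eval (σ v) (g i) = α (v i)) ∧
      ∀ v i, MvPolynomial.eval v (k i) = α.symm (σ v i) := by
    cases n with
    | zero => exact ⟨RingEquiv.refl P, 0, 0, fun _ i => i.elim0, fun _ i => i.elim0⟩
    | succ n => exact exists_semiPolynomial 0 τ σ hσ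
  -- η₂ is pullback along the polynomial bijection α⁻¹ ∘ σ, and η₁ along its inverse.
  let η₁ : MvPolynomial (Fin n) P →ₐ[P] MvPolynomial (Fin n) P :=
    MvPolynomial.aeval fun i => MvPolynomial.map (α.symm : P →+* P) (g i)
  let η₂ : MvPolynomial (Fin n) P →ₐ[P] MvPolynomial (Fin n) P := MvPolynomial.aeval k
  have h₁ : ∀ c q, MvPolynomial.eval (fun i => α.symm (σ c i)) (η₁ q) = MvPolynomial.eval c q := by
    intro c q
    rw [eval_algHom_apply]
    congr 2
    funext i
    simp only [pointMap, η₁, MvPolynomial.aeval_X]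
    rw [MvPolynomial.eval_map_ringEquiv]
    simp [hg]
  have h₂ : ∀ c q, MvPolynomial.eval c (η₂ q) = MvPolynomial.eval (fun i => α.symm (σ c i)) q := by
    intro c q
    rw [eval_algHom_apply]
    congr 2
    funext i
    simp [pointMap, η₂, hk]
  have h₁₂ : η₁.comp η₂ = AlgHom.id P _ := by
    refine AlgHom.ext fun q => MvPolynomial.funext fun w => ?_
    obtain ⟨c, rfl⟩ : ∃ c, (fun i => α.symm (σ c i)) = w :=
      ⟨σ.symm fun i => α (w i), by simp⟩
    rw [AlgHom.comp_apply, h₁, h₂, AlgHom.id_apply]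
  have h₂₁ : η₂.comp η₁ = AlgHom.id P _ := by
    refine AlgHom.ext fun q => MvPolynomial.funext fun c => ?_
    rw [AlgHom.comp_apply, h₂, h₁, AlgHom.id_apply]
  refine ⟨α, AlgEquiv.ofAlgHom η₁ η₂ h₁₂ h₂₁, fun s => ?_⟩
  let μ := semiInnerBijection α (AlgEquiv.ofAlgHom η₁ η₂ h₁₂ h₂₁)
  have hμ : ∀ c q, MvPolynomial.eval (σ c) (μ q) = α (MvPolynomial.eval c q) := by
    intro c q
    rw [← h₁ c q]
    exact MvPolynomial.eval_map_ringEquiv α (σ c) (η₁ q)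
  funext q
  obtain ⟨p, rfl⟩ := μ.surjective q
  change τ s (μ p) = μ (s (μ.symm (μ p)))
  rw [Equiv.symm_apply_apply]
  refine MvPolynomial.funext fun v => ?_
  obtain ⟨c, rfl⟩ := σ.surjective v
  rw [hμ, eval_algHom_apply, eval_algHom_apply, hσ, hμ]
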